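/- For all simple graphs $F$ and $G$ (finite or infinite), $$\operatorname{coind}(B(F\times G))=\min\{\operatorname{coind}(B(F)),\operatorname{coind}(B(G))\}.$$ Here $F\times G$ is the direct (categorical) product: its vertex set is $V(F)\times V(G)$, and $(f_1,g_1)$ and $(f_2,g_2)$ are adjacent if and only if $f_1f_2\in E(F)$ and $g_1g_2\in E(G)$. The box complex $B(G)$ is the simplicial complex whose simplices are the nonempty finite sets $A\uplus B:=A\times\{1\}\cup B\times\{2\}$ with $A,B\subseteq V(G)$ such that every vertex of $A$ is adjacent to every vertex of $B$ and, if one of $A,B$ is empty, the vertices of the other have a common neighbor. Its geometric realization (with the usual weak topology, which is the Euclidean one if $G$ is finite) is a $\mathbb Z_2$-space under the involution generated by $A\uplus B\mapsto B\uplus A$. For a $\mathbb Z_2$-space $T$, i.e. a topological space with a continuous involution, $\operatorname{coind}(T)\in\{-1,0,1,\dots\}\cup\{\infty\}$ is the supremum of the integers $h\ge -1$ for which there is a continuous map from $\mathbb S^h$ to $T$ that commutes with the involutions, where $\mathbb S^h$ is the unit sphere of $\mathbb R^{h+1}$ with the antipodal map and $\mathbb S^{-1}=\emptyset$. -/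

import Mathlib

/-! ### Spaces with an involution and their coindex -/

/-- A `ℤ₂`-space: a topological space together with a continuous involution. -/
structure Z2Space where
  carrier : Type*
  [top : TopologicalSpace carrier]
  inv : carrier → carrier
  continuous_inv : Continuous inv
  involutive_inv : Function.Involutive inv

attribute [instance] Z2Space.top

/-- A `ℤ₂`-map: a continuous map that commutes with the involutions. -/
structure Z2Map (S T : Z2Space) where
  toFun : S.carrier → T.carrier
  continuous_toFun : Continuous toFun
  map_inv : ∀ x, toFun (S.inv x) = T.inv (toFun x)

/-- The unit sphere of `ℝⁿ`, of dimension `n - 1`, with the antipodal map.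
For `n = 0` this is the empty space, the sphere of dimension `-1`. -/
noncomputable def antipodalSphere (n : ℕ) : Z2Space where
  carrier := Metric.sphere (0 : EuclideanSpace ℝ (Fin n)) 1
  inv x := -x
  continuous_inv := continuous_neg
  involutive_inv := neg_involutive

/-- The `ℤ₂`-coindex: the largest dimension `n - 1` of a sphere from which there is a `ℤ₂`-map
to `T`. It is `-1` if only the empty sphere maps to `T`, and `⊤` if there is no largest one. -/
noncomputable def coind (T : Z2Space) : EReal :=
  sSup {d : EReal | ∃ n : ℕ, Nonempty (Z2Map (antipodalSphere n) T) ∧ d = (n : EReal) - 1}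

/-! ### Geometric realization of an abstract simplicial complex -/

/-- The points of the geometric realization: formal convex combinations of vertices whose
support is a face. -/
def Realization {ι : Type*} (K : PreAbstractSimplicialComplex ι) : Type _ :=
  {p : ι →₀ ℝ // p.support ∈ K ∧ (∀ i, 0 ≤ p i) ∧ (p.sum fun _ t => t) = 1}

/-- The closed cell of the realization that belongs to a set `s` of vertices. -/
def Realization.Cell {ι : Type*} (K : PreAbstractSimplicialComplex ι) (s : Finset ι) : Type _ :=
  {p : Realization K // p.1.support ⊆ s}

/-- A closed cell carries the Euclidean topology, given by the barycentric coordinates. -/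
instance {ι : Type*} (K : PreAbstractSimplicialComplex ι) (s : Finset ι) :
    TopologicalSpace (Realization.Cell K s) :=
  TopologicalSpace.induced (fun (p : Realization.Cell K s) (i : s) => (p.1.1 i.1 : ℝ)) inferInstance

/-- The usual (weak) topology of the realization: a set is open if and only if it meets the closed
cell of every face in an open subset of that cell. -/
instance {ι : Type*} (K : PreAbstractSimplicialComplex ι) : TopologicalSpace (Realization K) :=
  ⨆ s : {s : Finset ι // s ∈ K}, TopologicalSpace.coinduced
    (fun p : Realization.Cell K s.1 => p.1) inferInstance

/-- The map of the realization that extends a simplicial permutation of the vertices. -/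
def Realization.permute {ι : Type*} {K : PreAbstractSimplicialComplex ι} (e : ι ≃ ι)
    (he : ∀ s ∈ K, s.map e.toEmbedding ∈ K) (p : Realization K) : Realization K :=
  ⟨p.1.equivMapDomain e, he _ p.2.1, fun i => p.2.2.1 (e.symm i), by
    rw [Finsupp.sum_equivMapDomain]; exact p.2.2.2⟩

theorem Realization.continuous_permute {ι : Type*} {K : PreAbstractSimplicialComplex ι} (e : ι ≃ ι)
    (he : ∀ s ∈ K, s.map e.toEmbedding ∈ K) : Continuous (Realization.permute e he) := by
  refine continuous_iSup_dom.2 fun s => continuous_coinduced_dom.2 ?_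
  let t : {s : Finset ι // s ∈ K} := ⟨s.1.map e.toEmbedding, he _ s.2⟩
  let g : Realization.Cell K s.1 → Realization.Cell K t.1 := fun p =>
    ⟨Realization.permute e he p.1, Finset.map_subset_map.2 p.2⟩
  have hg : Continuous g := by
    refine continuous_induced_rng.2 (continuous_pi fun i => ?_)
    have hi : e.symm i.1 ∈ s.1 := by
      obtain ⟨j, hj, hji⟩ := Finset.mem_map.1 i.2
      rw [← hji]
      simpa using hj
    have hd : Continuous fun (p : Realization.Cell K s.1) (j : s.1) => (p.1.1 j.1 : ℝ) :=
      continuous_induced_dom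
    exact (continuous_apply (⟨e.symm i.1, hi⟩ : {j // j ∈ s.1})).comp hd
  have ht : Continuous (fun p : Realization.Cell K t.1 => p.1) :=
    continuous_iff_coinduced_le.2 (le_iSup (fun s : {s : Finset ι // s ∈ K} =>
      TopologicalSpace.coinduced (fun p : Realization.Cell K s.1 => p.1) inferInstance) t)
  exact ht.comp hg

/-! ### Box complexes and direct products of graphs -/

/-- The simplicial complex of the box complex `B(G)`. Its vertices come from two disjoint copies of
`V`. A nonempty finite set `s = A ⊎ B` (with `A = s.toLeft` in the first copy and `B = s.toRight`
in the second) is a face if and only if every vertex of `A` is adjacent to every vertex of `B` and,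
if one of `A`, `B` is empty, the vertices of the other one have a common neighbor. -/
def boxFaces {V : Type*} (G : SimpleGraph V) : PreAbstractSimplicialComplex (V ⊕ V) where
  faces := {s | s.Nonempty ∧ (∀ a ∈ s.toLeft, ∀ b ∈ s.toRight, G.Adj a b) ∧
    (s.toRight = ∅ → ∃ w, ∀ a ∈ s.toLeft, G.Adj w a) ∧
    (s.toLeft = ∅ → ∃ w, ∀ b ∈ s.toRight, G.Adj w b)}
  isRelLowerSet_faces := by
    rintro s ⟨hs, hAB, hA, hB⟩
    refine ⟨hs, fun t hts ht => ?_⟩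
    have hl : t.toLeft ⊆ s.toLeft := Finset.toLeft_subset_toLeft hts
    have hr : t.toRight ⊆ s.toRight := Finset.toRight_subset_toRight hts
    refine ⟨ht, fun a ha b hb => hAB a (hl ha) b (hr hb), fun _ => ?_, fun _ => ?_⟩
    · rcases s.toRight.eq_empty_or_nonempty with h | ⟨b, hb⟩
      · obtain ⟨w, hw⟩ := hA h
        exact ⟨w, fun a ha => hw a (hl ha)⟩
      · exact ⟨b, fun a ha => (hAB a (hl ha) b hb).symm⟩
    · rcases s.toLeft.eq_empty_or_nonempty with h | ⟨a, ha⟩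
      · obtain ⟨w, hw⟩ := hB h
        exact ⟨w, fun b hb => hw b (hr hb)⟩
      · exact ⟨a, fun b hb => hAB a ha b (hr hb)⟩

/-- Exchanging the two copies, `A ⊎ B ↦ B ⊎ A`, preserves the faces. -/
theorem map_sumComm_mem_boxFaces {V : Type*} (G : SimpleGraph V) :
    ∀ s ∈ boxFaces G, s.map (Equiv.sumComm V V).toEmbedding ∈ boxFaces G := by
  rintro s ⟨hs, hAB, hA, hB⟩
  have hl : (s.map (Equiv.sumComm V V).toEmbedding).toLeft = s.toRight := by
    ext x; simp
  have hr : (s.map (Equiv.sumComm V V).toEmbedding).toRight = s.toLeft := by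
    ext x; simp
  refine ⟨hs.map, ?_, ?_, ?_⟩
  · rw [hl, hr]
    exact fun a ha b hb => (hAB b hb a ha).symm
  · rw [hl, hr]
    exact hB
  · rw [hl, hr]
    exact hA

/-- The box complex `B(G)` as a `ℤ₂`-space: the geometric realization with the involution generated
by the simplicial map `A ⊎ B ↦ B ⊎ A`. -/
def boxComplex {V : Type*} (G : SimpleGraph V) : Z2Space where
  carrier := Realization (boxFaces G)
  inv := Realization.permute (Equiv.sumComm V V) (map_sumComm_mem_boxFaces G)
  continuous_inv := Realization.continuous_permute _ _
  involutive_inv := fun p => by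
    apply Subtype.ext
    ext i
    simp [Realization.permute, Finsupp.equivMapDomain_apply]

/-- The direct (categorical) product of two graphs. -/
def directProduct {V W : Type*} (F : SimpleGraph V) (G : SimpleGraph W) :
    SimpleGraph (V × W) where
  Adj x y := F.Adj x.1 y.1 ∧ G.Adj x.2 y.2
  symm := ⟨fun _ _ h => ⟨h.1.symm, h.2.symm⟩⟩
  loopless := ⟨fun _ h => h.1.ne rfl⟩

/-!
Let `S` be a compact `ℤ₂`-space with involution `s ↦ -s`. A `ℤ₂`-map from `S` to `B(G)` is
determined by the barycentric coordinates `x_s : V → ℝ` of its values in the first copy of `V`,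
since those in the second copy are `x_{-s}`. Suppose that `x_s` never vanishes. Then the supports of
`x_s` and `x_{-s}` are always nonempty and completely joined, and conversely every such family of
weights, once normalized, is a `ℤ₂`-map to `B(G)`. The products `x_s v * y_s w` of such families
for `F` and `G` form one for the direct product; conversely, summing a family for the direct product
over the fibers of the projections gives families for `F` and `G`.

It remains to make `x_s` nowhere zero. By compactness only finitely many vertices are involved. Cut
off the small coordinates of `x_s`, and if `x_{-s}` has the larger total mass, add to `x_s` common
neighbors of the sets of vertices in the support of `x_{-s}` that contain all its large coordinates.
They are adjacent to everything that survives on the side of `-s`, and only one of the two sides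
receives them.
-/

/-! ### Continuity into and out of the realization -/

namespace Realization

variable {ι X : Type*} [TopologicalSpace X] {K : PreAbstractSimplicialComplex ι}

theorem continuous_cell_val {s : Finset ι} (hs : s ∈ K) : Continuous fun p : Cell K s => p.1 :=
  continuous_iff_coinduced_le.2 (le_iSup (fun s : {s : Finset ι // s ∈ K} =>
    TopologicalSpace.coinduced (fun p : Cell K s.1 => p.1) inferInstance) ⟨s, hs⟩)

theorem continuous_sum_mul (K : PreAbstractSimplicialComplex ι) (c : ι → ℝ) :
    Continuous fun p : Realization K => p.1.sum fun i t => c i * t := by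
  refine continuous_iSup_dom.2 fun s => continuous_coinduced_dom.2 ?_
  have sum_on_cell : (fun p : Realization K => p.1.sum fun i t => c i * t) ∘
      (fun p : Cell K s.1 => p.1) = fun p => ∑ i : s.1, c i * p.1.1 i := by
    funext p
    exact (Finsupp.sum_of_support_subset _ p.2 _ fun i _ => mul_zero (c i)).trans
      (Finset.sum_coe_sort s.1 fun i => c i * p.1.1 i).symm
  have continuous_coord_on_cell : Continuous fun (p : Cell K s.1) (i : s.1) => (p.1.1 i.1 : ℝ) :=
    continuous_induced_dom
  rw [sum_on_cell]
  exact continuous_finsetSum _ fun i _ =>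
    continuous_const.mul ((continuous_apply i).comp continuous_coord_on_cell)

theorem continuous_coord (K : PreAbstractSimplicialComplex ι) (i : ι) :
    Continuous fun p : Realization K => (p.1 i : ℝ) := by
  classical
  convert continuous_sum_mul K (Pi.single i 1) using 2 with p
  simp [Finsupp.sum, Pi.single_apply]

theorem finite_vertices_of_isCompact {C : Set (Realization K)} (hC : IsCompact C) :
    {i : ι | ∃ p ∈ C, p.1 i ≠ 0}.Finite := by
  by_contra infinite_vertices
  let e := Set.Infinite.natEmbedding _ infinite_vertices
  choose q hqC hq using fun n => (e n).2
  -- The coefficients `c` make the continuous function `p ↦ ∑ i, c i * p i` unbounded on `C`.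
  let c : ι → ℝ := Function.extend (fun n => (e n : ι)) (fun n => n / (q n).1 (e n)) 0
  have c_apply (n : ℕ) : c (e n) = n / (q n).1 (e n) :=
    (Subtype.val_injective.comp e.injective).extend_apply _ _ n
  have c_nonneg (i : ι) : 0 ≤ c i := by
    by_cases h : ∃ n, (e n : ι) = i
    · obtain ⟨n, rfl⟩ := h
      rw [c_apply]
      exact div_nonneg n.cast_nonneg ((q n).2.2.1 _)
    · exact (Function.extend_apply' _ (0 : ι → ℝ) i h).ge
  obtain ⟨M, hM⟩ := (hC.image (continuous_sum_mul K c)).bddAbove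
  obtain ⟨n, hn⟩ := exists_nat_gt M
  refine hn.not_ge ?_
  calc (n : ℝ) = c (e n) * (q n).1 (e n) := by rw [c_apply, div_mul_cancel₀ _ (hq n)]
    _ ≤ (q n).1.sum fun i t => c i * t :=
      Finset.single_le_sum (f := fun i => c i * (q n).1 i)
        (fun i _ => mul_nonneg (c_nonneg i) ((q n).2.2.1 i)) (Finsupp.mem_support_iff.2 (hq n))
    _ ≤ M := hM ⟨q n, hqC n, rfl⟩

theorem isClosed_setOf_support_subset {w : X → ι →₀ ℝ} (hw : ∀ i, Continuous fun x => w x i)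
    (s : Finset ι) : IsClosed {x | (w x).support ⊆ s} := by
  have : {x | (w x).support ⊆ s} = ⋂ i, ⋂ _ : i ∉ s, {x | w x i = 0} := by
    ext x
    simp only [Set.mem_ofPred_eq, Set.mem_iInter, Finset.subset_iff, Finsupp.mem_support_iff]
    exact forall_congr' fun i => not_imp_comm
  rw [this]
  exact isClosed_iInter fun i => isClosed_iInter fun _ => isClosed_eq (hw i) continuous_const

theorem continuous_of_coord {f : X → Realization K} (T : Finset ι)
    (hT : ∀ x, (f x).1.support ⊆ T) (hf : ∀ i, Continuous fun x => ((f x).1 i : ℝ)) :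
    Continuous f := by
  let faces := {s : Finset ι // s ∈ T.powerset ∧ s ∈ K}
  have : Finite faces := (T.powerset.finite_toSet.subset fun _ h => h.1 :
    {s : Finset ι | s ∈ T.powerset ∧ s ∈ K}.Finite)
  refine (locallyFinite_of_finite fun s : faces => {x | (f x).1.support ⊆ s.1}).continuous
    ?_ (fun s => isClosed_setOf_support_subset hf s.1) fun s => ?_
  · exact Set.eq_univ_of_forall fun x => Set.mem_iUnion.2
      ⟨⟨(f x).1.support, Finset.mem_powerset.2 (hT x), (f x).2.1⟩, Finset.Subset.refl _⟩
  · rw [continuousOn_iff_continuous_domRestrict]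
    let toCell : {x | (f x).1.support ⊆ s.1} → Cell K s.1 := fun x => ⟨f x.1, x.2⟩
    have continuous_toCell : Continuous toCell :=
      continuous_induced_rng.2 (continuous_pi fun i => (hf i.1).comp continuous_subtype_val)
    exact (continuous_cell_val s.2.2).comp continuous_toCell

theorem sum_pos_of_support_mem {w : ι →₀ ℝ} (h₀ : ∀ i, 0 ≤ w i) (hw : w.support ∈ K) :
    0 < w.sum fun _ t => t :=
  Finset.sum_pos (fun i hi => (h₀ i).lt_of_ne' (Finsupp.mem_support_iff.1 hi))
    (K.isRelLowerSet_faces hw).1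

/-- The point of the realization whose barycentric coordinates are proportional to given weights
on the vertices of a face. -/
noncomputable def ofWeights (w : ι →₀ ℝ) (h₀ : ∀ i, 0 ≤ w i) (hw : w.support ∈ K) :
    Realization K :=
  have sum_pos := sum_pos_of_support_mem h₀ hw
  ⟨(w.sum fun _ t => t)⁻¹ • w, by rwa [Finsupp.support_smul_eq (inv_pos.2 sum_pos).ne'],
    fun i => mul_nonneg (inv_pos.2 sum_pos).le (h₀ i), by
      rw [Finsupp.sum_smul_index fun _ => rfl, ← Finsupp.mul_sum, inv_mul_cancel₀ sum_pos.ne']⟩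

theorem permute_ofWeights (e : ι ≃ ι) (he : ∀ s ∈ K, s.map e.toEmbedding ∈ K) {w w' : ι →₀ ℝ}
    (h₀ : ∀ i, 0 ≤ w i) (hw : w.support ∈ K) (h₀' : ∀ i, 0 ≤ w' i) (hw' : w'.support ∈ K)
    (h : w' = w.equivMapDomain e) :
    ofWeights w' h₀' hw' = permute e he (ofWeights w h₀ hw) := by
  subst h
  refine Subtype.ext (Finsupp.ext fun i => ?_)
  simp [ofWeights, permute, Finsupp.sum_equivMapDomain, Finsupp.equivMapDomain_apply]

theorem continuous_ofWeights {w : X → ι →₀ ℝ} (h₀ : ∀ x i, 0 ≤ w x i)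
    (hw : ∀ x, (w x).support ∈ K) (T : Finset ι) (hT : ∀ x, (w x).support ⊆ T)
    (hc : ∀ i, Continuous fun x => w x i) : Continuous fun x => ofWeights (w x) (h₀ x) (hw x) := by
  have continuous_sum : Continuous fun x => (w x).sum fun _ t => t := by
    have sum_eq (x : X) : ((w x).sum fun _ t => t) = ∑ i ∈ T, w x i :=
      Finsupp.sum_of_support_subset _ (hT x) _ fun _ _ => rfl
    simp only [sum_eq]
    exact continuous_finsetSum _ fun i _ => hc i
  refine continuous_of_coord T (fun x => Finsupp.support_smul.trans (hT x)) fun i => ?_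
  exact (continuous_sum.inv₀ fun x => (sum_pos_of_support_mem (h₀ x) (hw x)).ne').mul (hc i)

end Realization

/-! ### Joined weights -/

section Weights

variable {V W : Type*} {S : Z2Space}

/-- Weights on the vertices of `G` that depend continuously on a point of `S` and involve only
finitely many vertices, such that the support at a point and the support at its image under the
involution are completely joined. The supports may be empty. -/
structure BipartiteWeight (S : Z2Space) (G : SimpleGraph V) where
  wt : S.carrier → V → ℝ
  continuous_wt : ∀ v, Continuous fun s => wt s v
  wt_nonneg : ∀ s v, 0 ≤ wt s v
  verts : Finset V
  mem_verts : ∀ {s v}, wt s v ≠ 0 → v ∈ verts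
  adj : ∀ {s a b}, wt s a ≠ 0 → wt (S.inv s) b ≠ 0 → G.Adj a b

/-- Weights of this kind are the barycentric coordinates in the first copy of the vertices, up to
normalization, of a `ℤ₂`-map to the box complex that involves only finitely many vertices. -/
structure BoxWeight (S : Z2Space) (G : SimpleGraph V) extends BipartiteWeight S G where
  exists_ne_zero_or : ∀ s, (∃ a, wt s a ≠ 0) ∨ ∃ b, wt (S.inv s) b ≠ 0
  exists_common_neighbor : ∀ s, ∃ z, ∀ a, wt s a ≠ 0 → G.Adj z a

/-- Bipartite weights with nonempty supports: they describe the `ℤ₂`-maps to the box complex that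
avoid the faces `A ⊎ B` with `A` or `B` empty. -/
structure JoinedWeight (S : Z2Space) (G : SimpleGraph V) extends BipartiteWeight S G where
  exists_ne_zero : ∀ s, ∃ v, wt s v ≠ 0

namespace JoinedWeight

variable {F : SimpleGraph V} {G : SimpleGraph W}

/-- The product of joined weights, on the direct product of the graphs. -/
def prod (x : JoinedWeight S F) (y : JoinedWeight S G) :
    JoinedWeight S (directProduct F G) where
  wt s v := x.wt s v.1 * y.wt s v.2
  continuous_wt v := (x.continuous_wt v.1).mul (y.continuous_wt v.2)
  wt_nonneg s v := mul_nonneg (x.wt_nonneg s v.1) (y.wt_nonneg s v.2)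
  verts := x.verts ×ˢ y.verts
  mem_verts h := Finset.mem_product.2
    ⟨x.mem_verts (left_ne_zero_of_mul h), y.mem_verts (right_ne_zero_of_mul h)⟩
  adj ha hb := ⟨x.adj (left_ne_zero_of_mul ha) (left_ne_zero_of_mul hb),
    y.adj (right_ne_zero_of_mul ha) (right_ne_zero_of_mul hb)⟩
  exists_ne_zero s :=
    have ⟨v, hv⟩ := x.exists_ne_zero s
    have ⟨w, hw⟩ := y.exists_ne_zero s
    ⟨(v, w), mul_ne_zero hv hw⟩

open Classical in
/-- The pushforward of joined weights along a graph homomorphism: weights are summed over the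
fibers. -/
noncomputable def map (φ : F →g G) (x : JoinedWeight S F) : JoinedWeight S G where
  wt s w := ∑ v ∈ x.verts with φ v = w, x.wt s v
  continuous_wt _ := continuous_finsetSum _ fun v _ => x.continuous_wt v
  wt_nonneg s _ := Finset.sum_nonneg fun v _ => x.wt_nonneg s v
  verts := x.verts.image φ
  mem_verts h :=
    have ⟨v, hv, _⟩ := Finset.exists_ne_zero_of_sum_ne_zero h
    Finset.mem_image.2 ⟨v, Finset.mem_filter.1 hv⟩
  adj ha hb := by
    obtain ⟨a, ha, hxa⟩ := Finset.exists_ne_zero_of_sum_ne_zero ha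
    obtain ⟨b, hb, hxb⟩ := Finset.exists_ne_zero_of_sum_ne_zero hb
    rw [← (Finset.mem_filter.1 ha).2, ← (Finset.mem_filter.1 hb).2]
    exact φ.map_adj (x.adj hxa hxb)
  exists_ne_zero s := by
    obtain ⟨v, hv⟩ := x.exists_ne_zero s
    refine ⟨φ v, (Finset.sum_pos' (fun v _ => x.wt_nonneg s v) ⟨v, ?_, ?_⟩).ne'⟩
    · exact Finset.mem_filter.2 ⟨x.mem_verts hv, rfl⟩
    · exact (x.wt_nonneg s v).lt_of_ne' hv

theorem nonempty_directProduct_iff :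
    Nonempty (JoinedWeight S (directProduct F G)) ↔
      Nonempty (JoinedWeight S F) ∧ Nonempty (JoinedWeight S G) :=
  ⟨fun ⟨x⟩ => ⟨⟨x.map ⟨Prod.fst, And.left⟩⟩, ⟨x.map ⟨Prod.snd, And.right⟩⟩⟩,
    fun ⟨⟨x⟩, ⟨y⟩⟩ => ⟨x.prod y⟩⟩

/-- The weights at `s` on the first copy of the vertices and those at the image of `s` under the
involution on the second copy. -/
noncomputable def doubled (x : JoinedWeight S F) (s : S.carrier) : V ⊕ V →₀ ℝ :=
  Finsupp.onFinset (x.verts.disjSum x.verts) (Sum.elim (x.wt s) (x.wt (S.inv s))) <| by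
    rintro (v | v) h
    exacts [Finset.inl_mem_disjSum.2 (x.mem_verts h), Finset.inr_mem_disjSum.2 (x.mem_verts h)]

theorem doubled_nonneg (x : JoinedWeight S F) (s : S.carrier) : ∀ i, 0 ≤ x.doubled s i :=
  Sum.rec (x.wt_nonneg s) (x.wt_nonneg (S.inv s))

theorem continuous_doubled (x : JoinedWeight S F) : ∀ i, Continuous fun s => x.doubled s i :=
  Sum.rec x.continuous_wt fun v => (x.continuous_wt v).comp S.continuous_inv

theorem doubled_inv (x : JoinedWeight S F) (s : S.carrier) :
    x.doubled (S.inv s) = (x.doubled s).equivMapDomain (Equiv.sumComm V V) := by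
  ext (v | v)
  · rfl
  · exact congrArg (x.wt · v) (S.involutive_inv s)

theorem support_doubled_mem (x : JoinedWeight S F) (s : S.carrier) :
    (x.doubled s).support ∈ boxFaces F := by
  have mem_toLeft {a : V} : a ∈ (x.doubled s).support.toLeft ↔ x.wt s a ≠ 0 := by
    simp [doubled]
  have mem_toRight {b : V} : b ∈ (x.doubled s).support.toRight ↔ x.wt (S.inv s) b ≠ 0 := by
    simp [doubled]
  obtain ⟨a, ha⟩ := x.exists_ne_zero s
  obtain ⟨b, hb⟩ := x.exists_ne_zero (S.inv s)
  exact ⟨⟨Sum.inl a, Finset.mem_toLeft.1 (mem_toLeft.2 ha)⟩,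
    fun a ha b hb => x.adj (mem_toLeft.1 ha) (mem_toRight.1 hb),
    fun h => absurd h (Finset.ne_empty_of_mem (mem_toRight.2 hb)),
    fun h => absurd h (Finset.ne_empty_of_mem (mem_toLeft.2 ha))⟩

/-- The `ℤ₂`-map to the box complex obtained by normalizing joined weights. -/
noncomputable def toZ2Map (x : JoinedWeight S F) : Z2Map S (boxComplex F) where
  toFun s := Realization.ofWeights (x.doubled s) (x.doubled_nonneg s) (x.support_doubled_mem s)
  continuous_toFun := Realization.continuous_ofWeights _ _ (x.verts.disjSum x.verts)
    (fun _ => Finsupp.support_onFinset_subset) x.continuous_doubled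
  map_inv s :=
    Realization.permute_ofWeights _ (map_sumComm_mem_boxFaces F) _ _ _ _ (x.doubled_inv s)

end JoinedWeight

/-! ### From maps to joined weights -/

variable {G : SimpleGraph V}

/-- The barycentric coordinates in the first copy of the vertices of a `ℤ₂`-map from a compact space
to the box complex. -/
noncomputable def BoxWeight.ofZ2Map [CompactSpace S.carrier] (f : Z2Map S (boxComplex G)) :
    BoxWeight S G :=
  let p : S.carrier → Realization (boxFaces G) := f.toFun
  have continuous_p : Continuous p := f.continuous_toFun
  have p_inv (s : S.carrier) (v : V) : (p (S.inv s)).1 (Sum.inl v) = (p s).1 (Sum.inr v) :=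
    congrArg (fun q : Realization (boxFaces G) => (q.1 (Sum.inl v) : ℝ)) (f.map_inv s)
  have finite_verts : {v | ∃ q ∈ Set.range p, q.1 (Sum.inl v) ≠ 0}.Finite :=
    (Realization.finite_vertices_of_isCompact (isCompact_range continuous_p)).preimage
      (f := Sum.inl) Sum.inl_injective.injOn
  have adj {s a b} (ha : (p s).1 (Sum.inl a) ≠ 0) (hb : (p (S.inv s)).1 (Sum.inl b) ≠ 0) :
      G.Adj a b :=
    (p s).2.1.2.1 a (by simpa using ha) b (by simpa [p_inv] using hb)
  { wt s v := (p s).1 (Sum.inl v)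
    continuous_wt v := (Realization.continuous_coord _ _).comp continuous_p
    wt_nonneg s v := (p s).2.2.1 _
    verts := finite_verts.toFinset
    mem_verts {s v} h := finite_verts.mem_toFinset.2 ⟨p s, ⟨s, rfl⟩, h⟩
    adj := adj
    exists_ne_zero_or s := by
      obtain ⟨a | b, h⟩ := (p s).2.1.1
      · exact Or.inl ⟨a, Finsupp.mem_support_iff.1 h⟩
      · exact Or.inr ⟨b, by simpa [p_inv] using h⟩
    exists_common_neighbor s := by
      by_cases h : ∃ b, (p (S.inv s)).1 (Sum.inl b) ≠ 0
      · obtain ⟨b, hb⟩ := h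
        exact ⟨b, fun a ha => (adj ha hb).symm⟩
      · obtain ⟨z, hz⟩ := (p s).2.1.2.2.1 <| Finset.eq_empty_of_forall_notMem fun b hb =>
          h ⟨b, by simpa [p_inv] using hb⟩
        exact ⟨z, fun a ha => hz a (by simpa using ha)⟩ }

/-- A common neighbor of the vertices in `A`, or an arbitrary vertex if there is none. -/
noncomputable def commonNeighbor [Nonempty V] (G : SimpleGraph V) (A : Finset V) : V :=
  Classical.epsilon fun z => ∀ a ∈ A, G.Adj z a

theorem commonNeighbor_adj [Nonempty V] {A : Finset V} (h : ∃ z, ∀ a ∈ A, G.Adj z a) {a : V}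
    (ha : a ∈ A) : G.Adj (commonNeighbor G A) a :=
  Classical.epsilon_spec h a ha

namespace BipartiteWeight

variable (x : BipartiteWeight S G)

/-- The total weight at a point. -/
noncomputable def mass (s : S.carrier) : ℝ :=
  ∑ v ∈ x.verts, x.wt s v

/-- The bound above which a weight counts as large. It is less than the average weight, so that
there are large weights whenever the mass is positive. -/
noncomputable def threshold (s : S.carrier) : ℝ :=
  x.mass s / (x.verts.card + 1)

open Classical in
/-- The weight of a set `A` of vertices, which is nonzero if and only if all vertices of `A` have
nonzero weight and all other vertices in `x.verts` have weight below the threshold. -/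
noncomputable def coverWeight (s : S.carrier) (A : Finset V) : ℝ :=
  (∏ a ∈ A, x.wt s a) * ∏ a ∈ x.verts \ A, (x.threshold s - x.wt s a)⁺

open Classical in
/-- The weights with the small ones cut off and, if the image of the point under the involution has
larger mass, with common neighbors of the sets that cover the large weights there. -/
noncomputable def joinedWt [Nonempty V] (s : S.carrier) (v : V) : ℝ :=
  (x.wt s v - x.threshold s)⁺ + (x.mass (S.inv s) - x.mass s)⁺ *
    ∑ A ∈ x.verts.powerset with commonNeighbor G A = v, x.coverWeight (S.inv s) A

theorem mass_nonneg (s : S.carrier) : 0 ≤ x.mass s :=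
  Finset.sum_nonneg fun v _ => x.wt_nonneg s v

theorem mass_pos {s : S.carrier} {v : V} (hv : x.wt s v ≠ 0) : 0 < x.mass s :=
  Finset.sum_pos' (fun v _ => x.wt_nonneg s v)
    ⟨v, x.mem_verts hv, (x.wt_nonneg s v).lt_of_ne' hv⟩

theorem continuous_mass : Continuous x.mass :=
  continuous_finsetSum _ fun v _ => x.continuous_wt v

theorem threshold_nonneg (s : S.carrier) : 0 ≤ x.threshold s :=
  div_nonneg (x.mass_nonneg s) (by positivity)

theorem threshold_pos {s : S.carrier} (hs : 0 < x.mass s) : 0 < x.threshold s :=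
  div_pos hs (by positivity)

theorem continuous_threshold : Continuous x.threshold :=
  x.continuous_mass.div_const _

variable {x} in
theorem wt_ne_zero_of_threshold_lt {s : S.carrier} {v : V} (hv : x.threshold s < x.wt s v) :
    x.wt s v ≠ 0 :=
  ((x.threshold_nonneg s).trans_lt hv).ne'

theorem exists_threshold_lt {s : S.carrier} (hs : 0 < x.mass s) :
    ∃ v, x.threshold s < x.wt s v := by
  by_contra! h
  have := calc
    x.mass s ≤ x.verts.card * x.threshold s := by
      simpa [mass] using Finset.sum_le_card_nsmul x.verts (x.wt s) _ fun v _ => h v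
    _ < (x.verts.card + 1) * x.threshold s := by
      linarith [x.threshold_pos hs]
    _ = x.mass s := mul_div_cancel₀ _ (by positivity)
  exact this.false

theorem coverWeight_nonneg (s : S.carrier) (A : Finset V) : 0 ≤ x.coverWeight s A :=
  mul_nonneg (Finset.prod_nonneg fun v _ => x.wt_nonneg s v)
    (Finset.prod_nonneg fun _ _ => posPart_nonneg _)

theorem continuous_coverWeight (A : Finset V) : Continuous fun s => x.coverWeight s A :=
  (continuous_finsetProd _ fun v _ => x.continuous_wt v).mul
    (continuous_finsetProd _ fun v _ =>
      continuous_posPart.comp (x.continuous_threshold.sub (x.continuous_wt v)))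

theorem coverWeight_ne_zero_iff {s : S.carrier} {A : Finset V} :
    x.coverWeight s A ≠ 0 ↔
      (∀ a ∈ A, x.wt s a ≠ 0) ∧ ∀ a ∈ x.verts, a ∉ A → x.wt s a < x.threshold s := by
  simp [coverWeight, Finset.prod_ne_zero_iff, posPart_eq_zero]

theorem exists_coverWeight_ne_zero {s : S.carrier} (hs : 0 < x.mass s) :
    ∃ A ∈ x.verts.powerset, x.coverWeight s A ≠ 0 := by
  classical
  refine ⟨x.verts.filter fun a => x.wt s a ≠ 0, by simp, x.coverWeight_ne_zero_iff.2
    ⟨fun a ha => (Finset.mem_filter.1 ha).2, fun a ha ha' => ?_⟩⟩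
  have wt_eq_zero : x.wt s a = 0 := by simpa [ha] using ha'
  exact wt_eq_zero ▸ x.threshold_pos hs

theorem commonNeighbor_adj_of_coverWeight_ne_zero [Nonempty V] {s : S.carrier}
    (hs : ∃ z, ∀ a, x.wt s a ≠ 0 → G.Adj z a) {A : Finset V} (hA : x.coverWeight s A ≠ 0) {a : V}
    (ha : x.threshold s < x.wt s a) : G.Adj (commonNeighbor G A) a := by
  obtain ⟨wt_ne_zero, wt_lt_threshold⟩ := x.coverWeight_ne_zero_iff.1 hA
  obtain ⟨z, hz⟩ := hs
  refine commonNeighbor_adj ⟨z, fun b hb => hz b (wt_ne_zero b hb)⟩ (by_contra fun a_notMem => ?_)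
  exact (wt_lt_threshold a (x.mem_verts (wt_ne_zero_of_threshold_lt ha)) a_notMem).not_gt ha

variable [Nonempty V]

theorem joinedWt_ne_zero_iff {s : S.carrier} {v : V} :
    x.joinedWt s v ≠ 0 ↔ x.threshold s < x.wt s v ∨ (x.mass s < x.mass (S.inv s) ∧
      ∃ A ∈ x.verts.powerset, commonNeighbor G A = v ∧ x.coverWeight (S.inv s) A ≠ 0) := by
  rw [joinedWt, Ne, add_eq_zero_iff_of_nonneg (posPart_nonneg _) (mul_nonneg (posPart_nonneg _)
      (Finset.sum_nonneg fun A _ => x.coverWeight_nonneg _ A)), not_and_or, mul_eq_zero, not_or,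
    Finset.sum_eq_zero_iff_of_nonneg fun A _ => x.coverWeight_nonneg _ A]
  simp [posPart_eq_zero]

theorem joinedWt_nonneg (s : S.carrier) (v : V) : 0 ≤ x.joinedWt s v :=
  add_nonneg (posPart_nonneg _)
    (mul_nonneg (posPart_nonneg _) (Finset.sum_nonneg fun A _ => x.coverWeight_nonneg _ A))

theorem continuous_joinedWt (v : V) : Continuous fun s => x.joinedWt s v := by
  refine (continuous_posPart.comp ((x.continuous_wt v).sub x.continuous_threshold)).add
    ((continuous_posPart.comp ((x.continuous_mass.comp S.continuous_inv).sub
      x.continuous_mass)).mul ?_)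
  exact continuous_finsetSum _ fun A _ => (x.continuous_coverWeight A).comp S.continuous_inv

theorem exists_joinedWt_ne_zero {s : S.carrier}
    (hs : (∃ a, x.wt s a ≠ 0) ∨ ∃ b, x.wt (S.inv s) b ≠ 0) : ∃ v, x.joinedWt s v ≠ 0 := by
  simp only [joinedWt_ne_zero_iff]
  rcases (x.mass_nonneg s).lt_or_eq with mass_pos | mass_eq_zero
  · obtain ⟨v, hv⟩ := x.exists_threshold_lt mass_pos
    exact ⟨v, Or.inl hv⟩
  · have mass_inv_pos : 0 < x.mass (S.inv s) := by
      obtain ⟨a, ha⟩ | ⟨b, hb⟩ := hs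
      exacts [absurd mass_eq_zero (x.mass_pos ha).ne, x.mass_pos hb]
    obtain ⟨A, hA, cover⟩ := x.exists_coverWeight_ne_zero mass_inv_pos
    exact ⟨commonNeighbor G A, Or.inr ⟨mass_eq_zero ▸ mass_inv_pos, A, hA, rfl, cover⟩⟩

theorem adj_of_joinedWt_ne_zero (hx : ∀ s, ∃ z, ∀ a, x.wt s a ≠ 0 → G.Adj z a) {s : S.carrier}
    {a b : V} (ha : x.joinedWt s a ≠ 0) (hb : x.joinedWt (S.inv s) b ≠ 0) : G.Adj a b := by
  rw [joinedWt_ne_zero_iff] at ha hb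
  rw [S.involutive_inv s] at hb
  obtain large_a | ⟨mass_lt, A, -, rfl, cover_A⟩ := ha <;>
    obtain large_b | ⟨mass_gt, B, -, rfl, cover_B⟩ := hb
  · exact x.adj (wt_ne_zero_of_threshold_lt large_a) (wt_ne_zero_of_threshold_lt large_b)
  · exact (x.commonNeighbor_adj_of_coverWeight_ne_zero (hx s) cover_B large_a).symm
  · exact x.commonNeighbor_adj_of_coverWeight_ne_zero (hx _) cover_A large_b
  · exact absurd mass_lt mass_gt.not_gt

end BipartiteWeight

open Classical in
/-- Box weights made nowhere zero. -/
noncomputable def BoxWeight.toJoinedWeight [Nonempty V] (x : BoxWeight S G) :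
    JoinedWeight S G where
  wt := x.joinedWt
  continuous_wt := x.continuous_joinedWt
  wt_nonneg := x.joinedWt_nonneg
  verts := x.verts ∪ x.verts.powerset.image (commonNeighbor G)
  mem_verts h := by
    rw [Finset.mem_union, Finset.mem_image]
    exact (x.joinedWt_ne_zero_iff.1 h).imp
      (fun large => x.mem_verts (BipartiteWeight.wt_ne_zero_of_threshold_lt large))
      fun ⟨_, A, hA, eq_v, _⟩ => ⟨A, hA, eq_v⟩
  adj := x.adj_of_joinedWt_ne_zero x.exists_common_neighbor
  exists_ne_zero s := x.exists_joinedWt_ne_zero (x.exists_ne_zero_or s)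

theorem BoxWeight.nonempty_joinedWeight (x : BoxWeight S G) : Nonempty (JoinedWeight S G) := by
  rcases isEmpty_or_nonempty S.carrier with hS | ⟨⟨s⟩⟩
  · exact ⟨⟨x.toBipartiteWeight, hS.elim⟩⟩
  · have : Nonempty V := ⟨(x.exists_common_neighbor s).choose⟩
    exact ⟨x.toJoinedWeight⟩

theorem nonempty_z2Map_boxComplex_iff [CompactSpace S.carrier] :
    Nonempty (Z2Map S (boxComplex G)) ↔ Nonempty (JoinedWeight S G) :=
  ⟨fun ⟨f⟩ => (BoxWeight.ofZ2Map f).nonempty_joinedWeight, fun ⟨x⟩ => ⟨x.toZ2Map⟩⟩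

end Weights

/-! ### Spheres and the coindex -/

/-- The composition of `ℤ₂`-maps. -/
def Z2Map.comp {R S T : Z2Space} (g : Z2Map S T) (f : Z2Map R S) : Z2Map R T where
  toFun := g.toFun ∘ f.toFun
  continuous_toFun := g.continuous_toFun.comp f.continuous_toFun
  map_inv x := by rw [Function.comp_apply, f.map_inv, g.map_inv, Function.comp_apply]

instance (n : ℕ) : CompactSpace (antipodalSphere n).carrier :=
  inferInstanceAs (CompactSpace (Metric.sphere (0 : EuclideanSpace ℝ (Fin n)) 1))

theorem nonempty_linearIsometry_of_finrank_le (𝕜 : Type*) {E E' : Type*} [RCLike 𝕜]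
    [NormedAddCommGroup E] [InnerProductSpace 𝕜 E] [FiniteDimensional 𝕜 E]
    [NormedAddCommGroup E'] [InnerProductSpace 𝕜 E'] [FiniteDimensional 𝕜 E']
    (h : Module.finrank 𝕜 E ≤ Module.finrank 𝕜 E') : Nonempty (E →ₗᵢ[𝕜] E') := by
  let b := stdOrthonormalBasis 𝕜 E
  let v := stdOrthonormalBasis 𝕜 E' ∘ Fin.castLE h
  have orthonormal_v : Orthonormal 𝕜 v :=
    (stdOrthonormalBasis 𝕜 E').orthonormal.comp _ (Fin.castLE_injective h)
  have constr_basis : b.toBasis.constr 𝕜 v ∘ b.toBasis = v :=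
    funext (b.toBasis.constr_basis 𝕜 v)
  exact ⟨(b.toBasis.constr 𝕜 v).isometryOfOrthonormal (v := b.toBasis)
    (by simp) (by rwa [constr_basis])⟩

theorem nonempty_z2Map_antipodalSphere {m n : ℕ} (h : m ≤ n) :
    Nonempty (Z2Map (antipodalSphere m) (antipodalSphere n)) := by
  obtain ⟨I⟩ : Nonempty (EuclideanSpace ℝ (Fin m) →ₗᵢ[ℝ] EuclideanSpace ℝ (Fin n)) :=
    nonempty_linearIsometry_of_finrank_le ℝ (by simpa using h)
  have I_mem_sphere (x : Metric.sphere (0 : EuclideanSpace ℝ (Fin m)) 1) :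
      I x ∈ Metric.sphere (0 : EuclideanSpace ℝ (Fin n)) 1 := by simp
  exact ⟨⟨fun x => ⟨I x.1, I_mem_sphere x⟩,
    (I.continuous.comp continuous_subtype_val).subtype_mk I_mem_sphere,
    fun x => Subtype.ext (I.map_neg x.1)⟩⟩

theorem coind_eq_min_of_nonempty_z2Map_iff {R S T : Z2Space}
    (h : ∀ n, Nonempty (Z2Map (antipodalSphere n) R) ↔
      Nonempty (Z2Map (antipodalSphere n) S) ∧ Nonempty (Z2Map (antipodalSphere n) T)) :
    coind R = min (coind S) (coind T) := by
  refine le_antisymm (le_min ?_ ?_) (le_of_forall_lt fun c hc => ?_)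
  · exact sSup_le_sSup fun _ ⟨n, hn, hd⟩ => ⟨n, ((h n).1 hn).1, hd⟩
  · exact sSup_le_sSup fun _ ⟨n, hn, hd⟩ => ⟨n, ((h n).1 hn).2, hd⟩
  · obtain ⟨lt_S, lt_T⟩ := lt_min_iff.1 hc
    obtain ⟨_, ⟨m, ⟨f⟩, rfl⟩, hm⟩ := lt_sSup_iff.1 lt_S
    obtain ⟨_, ⟨n, ⟨g⟩, rfl⟩, hn⟩ := lt_sSup_iff.1 lt_T
    obtain ⟨i⟩ := nonempty_z2Map_antipodalSphere (min_le_left m n)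
    obtain ⟨j⟩ := nonempty_z2Map_antipodalSphere (min_le_right m n)
    refine lt_of_lt_of_le ?_ (le_sSup ⟨min m n, (h _).2 ⟨⟨f.comp i⟩, ⟨g.comp j⟩⟩, rfl⟩)
    rcases min_choice m n with e | e <;> rw [e]
    exacts [hm, hn]

theorem mainTheorem5 {V W : Type*} (F : SimpleGraph V) (G : SimpleGraph W) :
    coind (boxComplex (directProduct F G)) =
      min (coind (boxComplex F)) (coind (boxComplex G)) := by
  refine coind_eq_min_of_nonempty_z2Map_iff fun n => ?_
  simp only [nonempty_z2Map_boxComplex_iff]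
  exact JoinedWeight.nonempty_directProduct_iff
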